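/- **Theorem (contact distance of a Thomas cluster process).** Let $\lambda_{\rm p}>0$, $\bar m\ge 0$, $\sigma>0$. Let $\Psi=\bigcup_{\mathbf x\in\Phi_{\rm p}}\mathcal B^{\mathbf x}$ be a Thomas cluster process in $\mathbb R^2$: the parents $\Phi_{\rm p}$ form a homogeneous Poisson point process of intensity $\lambda_{\rm p}$, and, independently of $\Phi_{\rm p}$ and of the other clusters, the cluster $\mathcal B^{\mathbf x}$ of each parent $\mathbf x$ consists of a Poisson number (with mean $\bar m$) of points $\mathbf x+\mathbf y$, whose displacements $\mathbf y$ are independent of each other and of that number and have the density $\frac{1}{2\pi\sigma^2}\exp\left(-\frac{\|\mathbf y\|^2}{2\sigma^2}\right)$ on $\mathbb R^2$. Let $\mathbf z\in\mathbb R^2$ be a fixed reference point (for instance the origin), and let $R_{\rm C}=\inf_{\mathbf w\in\Psi}\|\mathbf w-\mathbf z\|$ be the contact distance ($R_{\rm C}=\infty$ if $\Psi=\emptyset$). Then $R_{\rm C}$ is a random variable, and for every $r\ge 0$ $$F_{R_{\rm C}}(r)=\mathbb P(R_{\rm C}\le r)=\mathbb P\big(\Psi\text{ has a point in the closed ball of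 radius } r \text{ around } \mathbf z\big)=1-\exp\left(-2\pi\lambda_{\rm p}\int_0^\infty\left(1-\exp\left(-\bar m\left(1-Q_1\left(\tfrac{v}{\sigma},\tfrac{r}{\sigma}\right)\right)\right)\right)v\,dv\right),$$ where the integrals converge. Here $Q_1(\alpha,\beta)=\int_\beta^\infty y\,e^{-\frac{y^2+\alpha^2}{2}}I_0(\alpha y)\,dy$ is the Marcum Q-function, and $I_0(x)=\frac1\pi\int_0^\pi e^{x\cos\theta}\,d\theta$ is the modified Bessel function of the first kind of order zero. -/

import Mathlib

open MeasureTheory ProbabilityTheory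
open scoped NNReal ENNReal

namespace ThomasCluster

/-- The plane with its Euclidean norm. -/
abbrev Plane : Type := EuclideanSpace ℝ (Fin 2)

/-- The modified Bessel function of the first kind of order zero,
`I₀(x) = (1/π) ∫_0^π exp(x cos θ) dθ`. -/
noncomputable def besselI0 (x : ℝ) : ℝ :=
  Real.pi⁻¹ * ∫ θ in (0 : ℝ)..Real.pi, Real.exp (x * Real.cos θ)

/-- The integrand `y exp(-(y² + α²)/2) I₀(α y)` of the Marcum Q-function. -/
noncomputable def marcumIntegrand (α y : ℝ) : ℝ :=
  y * Real.exp (-(y ^ 2 + α ^ 2) / 2) * besselI0 (α * y)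

/-- The Marcum Q-function `Q₁(α, β) = ∫_β^∞ y exp(-(y² + α²)/2) I₀(α y) dy`. -/
noncomputable def marcumQ (α β : ℝ) : ℝ :=
  ∫ y in Set.Ioi β, marcumIntegrand α y

/-- The symmetric normal distribution on the plane with variance `σ²` per coordinate, through its
density `y ↦ exp(-‖y‖² / (2σ²)) / (2πσ²)`. -/
noncomputable def symmetricNormal (σ : ℝ) : Measure Plane :=
  (volume : Measure Plane).withDensity fun y =>
    ENNReal.ofReal (1 / (2 * Real.pi * σ ^ 2) * Real.exp (-‖y‖ ^ 2 / (2 * σ ^ 2)))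

variable {Ω : Type*} [MeasurableSpace Ω]

/-- The number of points, counted with multiplicity, that the random sequence `X` has in `B`. -/
noncomputable def pointCount (X : ℕ → Ω → Plane) (B : Set Plane) (ω : Ω) : ℕ∞ :=
  {i : ℕ | X i ω ∈ B}.encard

/-- The points of the random sequence `X` form a homogeneous Poisson point process with
intensity `lam`: the number of points in a Borel set `B` of finite area is Poisson distributed with
mean `lam * area B`, and the numbers of points in disjoint Borel sets are independent. -/
structure IsHomogeneousPPP (X : ℕ → Ω → Plane) (lam : ℝ≥0) (P : Measure Ω) : Prop where
  measurable : ∀ i, Measurable (X i)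
  hasLaw_count : ∀ B : Set Plane, MeasurableSet B → volume B ≠ ∞ →
    HasLaw (pointCount X B)
      ((poissonMeasure (lam * (volume B).toNNReal)).map (Nat.cast : ℕ → ℕ∞)) P
  indep_count : ∀ (n : ℕ) (B : Fin n → Set Plane), (∀ k, MeasurableSet (B k)) →
    Pairwise (fun k l => Disjoint (B k) (B l)) →
    iIndepFun (fun k => pointCount X (B k)) P

/-- The ingredients of a Thomas cluster process: the parents `X i` form a homogeneous Poisson point
process, the numbers of offspring `N i` are i.i.d. Poisson with mean `m`, the displacements `Y (i, j)`
of the offspring relative to their parents are i.i.d. symmetric normal with variance `σ²`, and these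
three families are independent of each other. -/
structure IsThomasConstruction (X : ℕ → Ω → Plane) (N : ℕ → Ω → ℕ) (Y : ℕ × ℕ → Ω → Plane)
    (lam m : ℝ≥0) (σ : ℝ) (P : Measure Ω) : Prop where
  parents : IsHomogeneousPPP X lam P
  measurable_number : ∀ i, Measurable (N i)
  hasLaw_number : ∀ i, HasLaw (N i) (poissonMeasure m) P
  indep_number : iIndepFun N P
  measurable_displacement : ∀ p, Measurable (Y p)
  hasLaw_displacement : ∀ p, HasLaw (Y p) (symmetricNormal σ) P
  indep_displacement : iIndepFun Y P
  indep_number_displacement :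
    IndepFun (fun ω (i : ℕ) => N i ω) (fun ω (p : ℕ × ℕ) => Y p ω) P
  indep_parents_offspring :
    IndepFun (fun ω (i : ℕ) => X i ω)
      (fun ω => ((fun i : ℕ => N i ω), (fun p : ℕ × ℕ => Y p ω))) P

/-- The cluster of the `i`-th parent: its `N i` offspring points `X i + Y (i, j)`. -/
def cluster (X : ℕ → Ω → Plane) (N : ℕ → Ω → ℕ) (Y : ℕ × ℕ → Ω → Plane) (i : ℕ) (ω : Ω) :
    Set Plane :=
  {y | ∃ j < N i ω, y = X i ω + Y (i, j) ω}

/-- The random set `Ψ` is a Thomas cluster process on `(Ω, P)`: almost surely, it is the union of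
the clusters around the points of a parent Poisson process. -/
def IsThomasClusterProcess (Ψ : Ω → Set Plane) (lam m : ℝ≥0) (σ : ℝ) (P : Measure Ω) : Prop :=
  ∃ (X : ℕ → Ω → Plane) (N : ℕ → Ω → ℕ) (Y : ℕ × ℕ → Ω → Plane),
    IsThomasConstruction X N Y lam m σ P ∧ ∀ᵐ ω ∂P, Ψ ω = ⋃ i, cluster X N Y i ω

/-- The contact distance: the distance from the reference point `z` to the nearest point of `Ψ`
(infinite if there is no point at all). -/
noncomputable def contactDistance (Ψ : Ω → Set Plane) (z : Plane) (ω : Ω) : ℝ≥0∞ :=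
  Metric.infEDist z (Ψ ω)

end ThomasCluster

/-!
The proof computes void probabilities. The set `Ψ` misses a Borel set `B` of finite area exactly
when every cluster misses it. Given the parents, the clusters are independent, and the cluster of
a parent at `x` is an independent thinning of a Poisson number of points: it misses `B` with
probability `exp (-m p(x))`, where `p(x)` (`hitProb`) is the probability that a normal
displacement carries `x` into `B`. This is the Poisson generating function `exp (-m (1 - s))` at
`s = 1 - p(x)`. Averaging over the parents gives `E[exp (-∑ᵢ m p(Xᵢ))]`, the Laplace functional of
the parent process, and `IsHomogeneousPPP.laplace` evaluates it as `exp (-lam ∫ (1 - exp (-m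
p(x))) dx)`. This is `IsThomasConstruction.measure_avoid`. The Laplace functional is obtained from
the counts alone: for step functions it is a product of Poisson generating functions, and the
general case follows by monotone approximation.

For a closed ball of radius `r` around `z`, polar coordinates around `z` show that the scaled
distance `‖x - z + y‖ / σ` of a displaced point from `z` has the Rice density `marcumIntegrand (‖x
- z‖ / σ)` (`lintegral_norm_add_symmetricNormal`). That density has total mass one, so `p(x)`
equals `1 - Q₁(‖x - z‖ / σ, r / σ)`, and a second passage to polar coordinates turns the area
integral into the radial integral of the theorem.

The infimum that defines the contact distance might not be attained, so `{R ≤ r}` is handled as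
the decreasing limit of the events that the balls of radius `r + 1 / (n + 1)` are hit. Since the
void probability of a ball is right-continuous in its radius, `{R ≤ r}` has the probability of the
event that the closed ball of radius `r` is hit; no local finiteness of `Ψ` is needed. The
probabilistic part is carried out in `[0, ∞]`; real integrals enter only with the Marcum
Q-function.
-/

namespace ThomasCluster

/-! ### The exponential on `[0, ∞]` and the Poisson generating function -/

/-- The function `t ↦ exp (-t)` on `[0, ∞]` with values in `[0, ∞]`, where `exp (-∞) = 0`. -/
noncomputable def expNeg (t : ℝ≥0∞) : ℝ≥0∞ := EReal.exp (-(t : EReal))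

lemma expNeg_zero : expNeg 0 = 1 := by simp [expNeg]

lemma expNeg_top : expNeg ∞ = 0 := by simp [expNeg]

lemma expNeg_ofReal {x : ℝ} (hx : 0 ≤ x) :
    expNeg (ENNReal.ofReal x) = ENNReal.ofReal (Real.exp (-x)) := by
  rw [expNeg, EReal.coe_ennreal_ofReal, max_eq_left hx, ← EReal.coe_neg, EReal.exp_coe]

lemma expNeg_of_ne_top {t : ℝ≥0∞} (ht : t ≠ ∞) :
    expNeg t = ENNReal.ofReal (Real.exp (-t.toReal)) := by
  rw [← expNeg_ofReal ENNReal.toReal_nonneg, ENNReal.ofReal_toReal ht]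

lemma toReal_expNeg {t : ℝ≥0∞} (ht : t ≠ ∞) : (expNeg t).toReal = Real.exp (-t.toReal) := by
  rw [expNeg_of_ne_top ht, ENNReal.toReal_ofReal (Real.exp_pos _).le]

lemma expNeg_add (s t : ℝ≥0∞) : expNeg (s + t) = expNeg s * expNeg t := by
  induction s with
  | top => simp [expNeg_top]
  | coe s =>
    induction t with
    | top => simp [expNeg_top]
    | coe t =>
      rw [← ENNReal.coe_add, expNeg_of_ne_top (by simp), expNeg_of_ne_top (by simp),
        expNeg_of_ne_top (by simp), ← ENNReal.ofReal_mul (Real.exp_pos _).le, ← Real.exp_add]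
      congr 2
      simp only [ENNReal.coe_toReal, NNReal.coe_add]
      ring

lemma expNeg_sum {ι : Type*} (s : Finset ι) (f : ι → ℝ≥0∞) :
    expNeg (∑ i ∈ s, f i) = ∏ i ∈ s, expNeg (f i) := by
  classical
  induction s using Finset.induction_on with
  | empty => simp [expNeg_zero]
  | insert a s ha ih => rw [Finset.sum_insert ha, Finset.prod_insert ha, expNeg_add, ih]

lemma expNeg_mul_natCast (t : ℝ≥0∞) (n : ℕ) : expNeg (t * n) = expNeg t ^ n := by
  induction n with
  | zero => simp [expNeg_zero]
  | succ n ih => rw [Nat.cast_succ, mul_add, mul_one, expNeg_add, ih, pow_succ]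

lemma expNeg_le_one (t : ℝ≥0∞) : expNeg t ≤ 1 := by
  rw [expNeg, EReal.exp_le_one_iff, EReal.neg_le_zero]
  exact EReal.coe_ennreal_nonneg t

lemma antitone_expNeg : Antitone expNeg := fun s t hst => by
  simpa only [expNeg, EReal.exp_le_exp_iff, EReal.neg_le_neg_iff,
    EReal.coe_ennreal_le_coe_ennreal_iff] using hst

lemma continuous_expNeg : Continuous expNeg :=
  EReal.expHomeomorph.continuous.comp (continuous_neg.comp continuous_coe_ennreal_ereal)

@[fun_prop]
lemma measurable_expNeg : Measurable expNeg := continuous_expNeg.measurable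

lemma one_sub_expNeg_le (t : ℝ≥0∞) : 1 - expNeg t ≤ t := by
  induction t with
  | top => simp
  | coe t =>
    rw [expNeg_of_ne_top (by simp), ← ENNReal.ofReal_one,
      ← ENNReal.ofReal_sub _ (Real.exp_pos _).le]
    refine ENNReal.ofReal_le_of_le_toReal ?_
    have := Real.add_one_le_exp (-(t : ℝ≥0∞).toReal)
    linarith

/-- The probability generating function of the Poisson distribution. -/
lemma lintegral_pow_poissonMeasure (r : ℝ≥0) {s : ℝ≥0∞} (hs : s ≤ 1) :
    ∫⁻ k, s ^ k ∂poissonMeasure r = expNeg (r * (1 - s)) := by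
  have hs' : s ≠ ∞ := ne_top_of_le_ne_top ENNReal.one_ne_top hs
  lift s to ℝ≥0 using hs'
  have hs1 : (s : ℝ) ≤ 1 := by exact_mod_cast hs
  rw [poissonMeasure, lintegral_sum_measure]
  simp only [lintegral_smul_measure, lintegral_dirac, smul_eq_mul]
  have hsum : HasSum (fun n : ℕ => Real.exp (-r) * r ^ n / n.factorial * (s : ℝ) ^ n)
      (Real.exp (-(r * (1 - s)))) := by
    convert! (NormedSpace.expSeries_div_hasSum_exp ((r : ℝ) * s)).mul_left (Real.exp (-r)) using 1
    · ext n; rw [mul_pow]; ring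
    · rw [← Real.exp_eq_exp_ℝ, ← Real.exp_add]; ring_nf
  have h1 : ((r : ℝ≥0∞) * (1 - s)).toReal = r * (1 - s) := by
    rw [ENNReal.toReal_mul, ENNReal.toReal_sub_of_le hs (by simp)]; simp
  rw [expNeg_of_ne_top (by finiteness), h1, ← hsum.tsum_eq,
    ENNReal.ofReal_tsum_of_nonneg (fun n => by positivity) hsum.summable]
  refine tsum_congr fun n => ?_
  rw [ENNReal.ofReal_mul (by positivity), ENNReal.ofReal_pow (by positivity)]
  simp

/-! ### The Laplace functional of a Poisson process -/

section

lemma tsum_indicator_eq_pointCount {Ω : Type*} (X : ℕ → Ω → Plane) (B : Set Plane)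
    (c : ℝ≥0∞) (ω : Ω) :
    ∑' i, B.indicator (fun _ => c) (X i ω) = c * (pointCount X B ω : ℝ≥0∞) := by
  have h : ∀ i, B.indicator (fun _ => c) (X i ω)
      = {i : ℕ | X i ω ∈ B}.indicator (fun _ => c) i := fun i => rfl
  simp_rw [h]
  rw [← tsum_subtype, ENNReal.tsum_set_const, pointCount, mul_comm]

/-- The value `0` is left out because its level set has infinite area in the cases of interest. -/
lemma tsum_simpleFunc {Ω : Type*} (X : ℕ → Ω → Plane) (g : SimpleFunc Plane ℝ≥0∞) (ω : Ω) :
    ∑' i, g (X i ω) = ∑ k : {y // y ∈ g.range.filter (· ≠ 0)},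
      k.1 * (pointCount X (g ⁻¹' {k.1}) ω : ℝ≥0∞) := by
  classical
  have h : ∀ x, g x = ∑ k : {y // y ∈ g.range.filter (· ≠ 0)},
      (g ⁻¹' {k.1}).indicator (fun _ => k.1) x := fun x => by
    rw [Finset.univ_eq_attach,
      Finset.sum_attach (g.range.filter (· ≠ 0)) (fun k => (g ⁻¹' {k}).indicator (fun _ => k) x)]
    by_cases hx : g x = 0
    · rw [hx, Finset.sum_eq_zero]
      intro k hk
      have hk0 : k ≠ 0 := (Finset.mem_filter.1 hk).2
      simp [hx, hk0.symm]
    · rw [Finset.sum_eq_single (g x)]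
      · simp
      · intro k _ hk
        simp [hk.symm]
      · intro hk
        simp [hx] at hk
  conv_lhs => enter [1, i]; rw [h]
  rw [Summable.tsum_finsetSum fun _ _ => ENNReal.summable]
  simp_rw [tsum_indicator_eq_pointCount]

variable {Ω : Type*} [MeasurableSpace Ω]

lemma IsHomogeneousPPP.lintegral_expNeg_count {X : ℕ → Ω → Plane} {lam : ℝ≥0} {P : Measure Ω}
    (hX : IsHomogeneousPPP X lam P) {B : Set Plane} (hB : MeasurableSet B) (hB' : volume B ≠ ∞)
    (c : ℝ≥0∞) :
    ∫⁻ ω, expNeg (c * (pointCount X B ω : ℝ≥0∞)) ∂P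
      = expNeg (lam * ((1 - expNeg c) * volume B)) := by
  rw [(hX.hasLaw_count B hB hB').lintegral_comp (f := fun k : ℕ∞ => expNeg (c * (k : ℝ≥0∞)))
    Measurable.of_discrete.aemeasurable,
    lintegral_map Measurable.of_discrete Measurable.of_discrete]
  simp_rw [ENat.toENNReal_coe, expNeg_mul_natCast]
  rw [lintegral_pow_poissonMeasure _ (expNeg_le_one c)]
  congr 1
  rw [ENNReal.coe_mul, ENNReal.coe_toNNReal hB']
  ring

/-- The Laplace functional of a Poisson process at a nonnegative step function: for disjoint sets
`B k` the counts are independent, and each contributes its Poisson generating function. -/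
lemma IsHomogeneousPPP.lintegral_expNeg_sum {X : ℕ → Ω → Plane} {lam : ℝ≥0} {P : Measure Ω}
    (hX : IsHomogeneousPPP X lam P) {ι : Type*} [Fintype ι] {B : ι → Set Plane}
    (hB : ∀ k, MeasurableSet (B k)) (hB' : ∀ k, volume (B k) ≠ ∞)
    (hdisj : Pairwise fun k l => Disjoint (B k) (B l))
    (c : ι → ℝ≥0∞) :
    ∫⁻ ω, expNeg (∑ k, c k * (pointCount X (B k) ω : ℝ≥0∞)) ∂P
      = expNeg (lam * ∑ k, (1 - expNeg (c k)) * volume (B k)) := by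
  classical
  let e := Fintype.equivFin ι
  have hind : iIndepFun (fun k => pointCount X (B k)) P := by
    have := (hX.indep_count _ (fun j => B (e.symm j)) (fun j => hB _)
      (fun k l hkl => hdisj (e.symm.injective.ne hkl))).precomp e.injective
    simpa using this
  have hind' : iIndepFun
      (fun k => (fun n : ℕ∞ => expNeg (c k * (n : ℝ≥0∞))) ∘ pointCount X (B k)) P :=
    hind.comp _ fun k => Measurable.of_discrete
  have hmeas : ∀ k, Measurable fun ω => expNeg (c k * (pointCount X (B k) ω : ℝ≥0∞)) := by
    intro k
    simp_rw [← tsum_indicator_eq_pointCount]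
    exact measurable_expNeg.comp (Measurable.tsum fun i =>
      (measurable_const.indicator (hB k)).comp (hX.measurable i))
  simp_rw [expNeg_sum]
  have := lintegral_prod_eq_prod_lintegral_of_indepFun Finset.univ _ hind' hmeas
  simp only [Function.comp_apply] at this
  rw [this, Finset.mul_sum, expNeg_sum]
  exact Finset.prod_congr rfl fun k _ => hX.lintegral_expNeg_count (hB k) (hB' k) (c k)

/-- The Laplace functional of a Poisson process. The integrability assumption on `f` lets it be
approximated by step functions that live on sets of finite area, the only sets whose counts are
known to be Poisson. -/
theorem IsHomogeneousPPP.laplace {X : ℕ → Ω → Plane} {lam : ℝ≥0} {P : Measure Ω}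
    [IsFiniteMeasure P] (hX : IsHomogeneousPPP X lam P) {f : Plane → ℝ≥0∞} (hf : Measurable f)
    (hfint : ∫⁻ x, f x ≠ ∞) :
    ∫⁻ ω, expNeg (∑' i, f (X i ω)) ∂P = expNeg (lam * ∫⁻ x, (1 - expNeg (f x))) := by
  have hXm := hX.measurable
  let g := SimpleFunc.eapprox f
  have hmono : ∀ x, Monotone fun n => g n x := fun x m n hmn => SimpleFunc.monotone_eapprox f hmn x
  have hlim : ∀ x, Filter.Tendsto (fun n => g n x) Filter.atTop (nhds (f x)) := fun x => by
    rw [← SimpleFunc.iSup_eapprox_apply hf x]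
    exact tendsto_atTop_iSup (hmono x)
  have hstep : ∀ n, ∫⁻ ω, expNeg (∑' i, g n (X i ω)) ∂P
      = expNeg (lam * ∫⁻ x, (1 - expNeg (g n x))) := fun n => by
    have hvol : ∀ k ≠ 0, volume (g n ⁻¹' {k}) ≠ ∞ := fun k hk =>
      ((measure_mono fun x hx => by
        rw [Function.mem_support, show g n x = k from hx]; exact hk).trans_lt
        (measure_support_eapprox_lt_top hf hfint n)).ne
    simp_rw [tsum_simpleFunc]
    rw [hX.lintegral_expNeg_sum (fun k => (g n).measurableSet_preimage _)
      (fun k => hvol k.1 ((Finset.mem_filter (p := (· ≠ 0))).1 k.2).2)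
      (fun k l hkl => Disjoint.preimage _
        (Set.disjoint_singleton.2 fun h => hkl (Subtype.ext h)))]
    congr 2
    rw [Finset.univ_eq_attach, Finset.sum_attach ((g n).range.filter (· ≠ 0))
          (fun k => (1 - expNeg k) * volume (g n ⁻¹' {k})), Finset.sum_filter_of_ne,
        ← SimpleFunc.map_lintegral, ← SimpleFunc.lintegral_eq_lintegral]
    · rfl
    · rintro k - hk rfl
      simp [expNeg_zero] at hk
  have hleft : Filter.Tendsto (fun n => ∫⁻ ω, expNeg (∑' i, g n (X i ω)) ∂P) Filter.atTop
      (nhds (∫⁻ ω, expNeg (∑' i, f (X i ω)) ∂P)) := by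
    refine tendsto_lintegral_of_dominated_convergence (fun _ => 1) (fun n => ?_)
      (fun n => ae_of_all _ fun ω => expNeg_le_one _) (by simp) (ae_of_all _ fun ω => ?_)
    · exact measurable_expNeg.comp
        (Measurable.tsum fun i => (g n).measurable.comp (hXm i))
    · refine (continuous_expNeg.tendsto _).comp ?_
      have : ∑' i, f (X i ω) = ⨆ n, ∑' i, g n (X i ω) := by
        simp_rw [← SimpleFunc.iSup_eapprox_apply hf]
        rw [ENNReal.tsum_eq_iSup_sum]
        simp_rw [ENNReal.tsum_eq_iSup_sum]
        rw [iSup_comm]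
        congr with s
        exact ENNReal.finsetSum_iSup_of_monotone fun i => hmono (X i ω)
      rw [this]
      exact tendsto_atTop_iSup fun m n hmn =>
        ENNReal.tsum_le_tsum fun i => hmono (X i ω) hmn
  have hright : Filter.Tendsto (fun n => ∫⁻ x, (1 - expNeg (g n x))) Filter.atTop
      (nhds (∫⁻ x, (1 - expNeg (f x)))) := by
    refine lintegral_tendsto_of_tendsto_of_monotone
      (fun n => (measurable_const.sub (measurable_expNeg.comp (g n).measurable)).aemeasurable)
      (ae_of_all _ fun x m n hmn => tsub_le_tsub_left (antitone_expNeg (hmono x hmn)) 1)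
      (ae_of_all _ fun x => ?_)
    exact ENNReal.Tendsto.sub tendsto_const_nhds ((continuous_expNeg.tendsto _).comp (hlim x))
      (Or.inl ENNReal.one_ne_top)
  refine tendsto_nhds_unique hleft ?_
  simp_rw [hstep]
  exact (continuous_expNeg.tendsto _).comp
    (ENNReal.Tendsto.const_mul hright (Or.inr ENNReal.coe_ne_top))

end

/-! ### Void probabilities of a Thomas cluster process -/

section

variable {Ω : Type*} [MeasurableSpace Ω]

/-- Fubini for two independent random variables: the first may be frozen at a value. -/
lemma _root_.ProbabilityTheory.IndepFun.measure_setOf_eq_lintegral {α β : Type*}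
    [MeasurableSpace α] [MeasurableSpace β] {P : Measure Ω} [IsFiniteMeasure P] {U : Ω → α}
    {V : Ω → β} (hUV : IndepFun U V P) (hU : Measurable U) (hV : Measurable V) {S : Set (α × β)}
    (hS : MeasurableSet S) :
    P {ω | (U ω, V ω) ∈ S} = ∫⁻ ω, P {ω' | (U ω, V ω') ∈ S} ∂P := by
  have h1 : P {ω | (U ω, V ω) ∈ S} = P.map (fun ω => (U ω, V ω)) S :=
    (Measure.map_apply (hU.prodMk hV) hS).symm
  rw [h1, (indepFun_iff_map_prod_eq_prod_map_map hU.aemeasurable hV.aemeasurable).1 hUV,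
    Measure.prod_apply hS, lintegral_map (measurable_measure_prodMk_left hS) hU]
  refine lintegral_congr fun ω => ?_
  rw [Measure.map_apply hV (measurable_prodMk_left hS)]
  rfl

/-- The probability that a normal displacement carries a parent at `x` into `B`. -/
noncomputable def hitProb (σ : ℝ) (B : Set Plane) (x : Plane) : ℝ≥0∞ :=
  symmetricNormal σ {y | x + y ∈ B}

lemma measurable_hitProb (σ : ℝ) [SFinite (symmetricNormal σ)] {B : Set Plane}
    (hB : MeasurableSet B) : Measurable (hitProb σ B) :=
  measurable_measure_prodMk_left (measurable_add hB)

lemma hitProb_mono (σ : ℝ) {A B : Set Plane} (hAB : A ⊆ B) (x : Plane) :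
    hitProb σ A x ≤ hitProb σ B x :=
  measure_mono fun _ hy => hAB hy

/-- Area is translation invariant, so averaging over the parent's position gives the area of `B`. -/
lemma lintegral_hitProb (σ : ℝ) [IsProbabilityMeasure (symmetricNormal σ)] {B : Set Plane}
    (hB : MeasurableSet B) : ∫⁻ x, hitProb σ B x = volume B := by
  have hS : MeasurableSet {p : Plane × Plane | p.1 + p.2 ∈ B} := measurable_add hB
  have h1 := Measure.prod_apply (μ := (volume : Measure Plane)) (ν := symmetricNormal σ) hS
  have h2 := Measure.prod_apply_symm (μ := (volume : Measure Plane)) (ν := symmetricNormal σ) hS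
  rw [h1] at h2
  refine h2.trans ?_
  have h3 : ∀ y : Plane, volume ((fun x => (x, y)) ⁻¹' {p : Plane × Plane | p.1 + p.2 ∈ B})
      = volume B := fun y => measure_preimage_add_right volume y B
  rw [lintegral_congr h3, lintegral_const, measure_univ, mul_one]

variable {X : ℕ → Ω → Plane} {N : ℕ → Ω → ℕ} {Y : ℕ × ℕ → Ω → Plane} {lam m : ℝ≥0} {σ : ℝ}
  {P : Measure Ω}

lemma IsThomasConstruction.isProbabilityMeasure_symmetricNormal [IsProbabilityMeasure P]
    (h : IsThomasConstruction X N Y lam m σ P) : IsProbabilityMeasure (symmetricNormal σ) := by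
  rw [← (h.hasLaw_displacement (0, 0)).map_eq]
  exact Measure.isProbabilityMeasure_map (h.measurable_displacement _).aemeasurable

/-- Deterministic parents with deterministic numbers of offspring: only the displacements are
random, and they are independent. -/
lemma IsThomasConstruction.measure_avoid_of_parents_of_numbers [IsProbabilityMeasure P]
    (h : IsThomasConstruction X N Y lam m σ P) {B : Set Plane} (hB : MeasurableSet B)
    (x : ℕ → Plane) (k : ℕ → ℕ) (n : ℕ) :
    P {ω | ∀ i < n, ∀ j < k i, x i + Y (i, j) ω ∉ B}
      = ∏ i ∈ Finset.range n, (1 - hitProb σ B (x i)) ^ k i := by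
  have := h.isProbabilityMeasure_symmetricNormal
  let e : (_ : ℕ) × ℕ → ℕ × ℕ := fun s => (s.1, s.2)
  have he : Function.Injective e := fun s t hst => by
    obtain ⟨a, b⟩ := s; obtain ⟨c, d⟩ := t
    simpa [e] using hst
  have hY := h.indep_displacement.precomp he
  have hmeas : ∀ z : Plane, MeasurableSet {y | z + y ∉ B} := fun z =>
    (measurable_const_add z) hB.compl
  have key := hY.measure_inter_preimage_eq_mul
    ((Finset.range n).sigma fun i => Finset.range (k i)) (sets := fun s => {y | x s.1 + y ∉ B})
    fun s _ => hmeas _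
  have hset : {ω | ∀ i < n, ∀ j < k i, x i + Y (i, j) ω ∉ B}
      = ⋂ s ∈ (Finset.range n).sigma fun i => Finset.range (k i),
          Y (e s) ⁻¹' {y | x s.1 + y ∉ B} := by
    ext ω
    simp only [Set.mem_ofPred_eq, Set.mem_iInter, Finset.mem_sigma, Finset.mem_range,
      Set.mem_preimage, Sigma.forall, e]
    exact ⟨fun H a b hab => H a hab.1 b hab.2, fun H i hi j hj => H i j ⟨hi, hj⟩⟩
  rw [hset, key, Finset.prod_sigma]
  refine Finset.prod_congr rfl fun i _ => ?_
  rw [← Finset.card_range (k i), ← Finset.prod_const, Finset.card_range]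
  refine Finset.prod_congr rfl fun j _ => ?_
  rw [← Measure.map_apply (h.measurable_displacement _) (hmeas _),
    (h.hasLaw_displacement _).map_eq]
  exact prob_compl_eq_one_sub (measurable_const_add (x i) hB)

/-- Deterministic parents: conditionally on the numbers of offspring the clusters avoid `B` with
probability `∏ i, (1 - hitProb σ B (x i)) ^ N i`, whose mean is a product of Poisson generating
functions. -/
lemma IsThomasConstruction.measure_avoid_of_parents [IsProbabilityMeasure P]
    (h : IsThomasConstruction X N Y lam m σ P) {B : Set Plane} (hB : MeasurableSet B)
    (x : ℕ → Plane) (n : ℕ) :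
    P {ω | ∀ i < n, ∀ j < N i ω, x i + Y (i, j) ω ∉ B}
      = ∏ i ∈ Finset.range n, expNeg (m * hitProb σ B (x i)) := by
  have := h.isProbabilityMeasure_symmetricNormal
  have hS : MeasurableSet {p : (ℕ → ℕ) × (ℕ × ℕ → Plane) |
      ∀ i < n, ∀ j < p.1 i, x i + p.2 (i, j) ∉ B} := by
    refine measurableSet_setOfPred.2 (Measurable.forall fun i => Measurable.imp measurable_const
      (Measurable.forall fun j => Measurable.imp ?_ (Measurable.not ?_)))
    · exact measurableSet_setOfPred.1 (measurableSet_lt measurable_const (by fun_prop))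
    · exact measurableSet_setOfPred.1 ((by fun_prop : Measurable
        fun p : (ℕ → ℕ) × (ℕ × ℕ → Plane) => x i + p.2 (i, j)) hB)
  have h1 := h.indep_number_displacement.measure_setOf_eq_lintegral
    (measurable_pi_lambda _ h.measurable_number) (measurable_pi_lambda _ h.measurable_displacement)
    hS
  simp only [Set.mem_ofPred_eq] at h1
  rw [h1]
  simp_rw [fun ω => h.measure_avoid_of_parents_of_numbers hB x (fun i => N i ω) n]
  have h2 := lintegral_prod_eq_prod_lintegral_of_indepFun (Finset.range n)
    (fun i ω => (1 - hitProb σ B (x i)) ^ N i ω)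
    (h.indep_number.comp (fun i (k : ℕ) => (1 - hitProb σ B (x i)) ^ k)
      fun i => Measurable.of_discrete)
    (fun i => (Measurable.of_discrete
      (f := fun k : ℕ => (1 - hitProb σ B (x i)) ^ k)).comp (h.measurable_number i))
  rw [h2]
  refine Finset.prod_congr rfl fun i _ => ?_
  rw [(h.hasLaw_number i).lintegral_comp (f := fun k : ℕ => (1 - hitProb σ B (x i)) ^ k)
    Measurable.of_discrete.aemeasurable, lintegral_pow_poissonMeasure _ tsub_le_self,
    ENNReal.sub_sub_cancel ENNReal.one_ne_top (show hitProb σ B (x i) ≤ 1 from prob_le_one)]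

/-- Conditioning on the parents, for the first `n` clusters. -/
lemma IsThomasConstruction.measure_avoid_lt [IsProbabilityMeasure P]
    (h : IsThomasConstruction X N Y lam m σ P) {B : Set Plane} (hB : MeasurableSet B) (n : ℕ) :
    P {ω | ∀ i < n, ∀ j < N i ω, X i ω + Y (i, j) ω ∉ B}
      = ∫⁻ ω, expNeg (∑ i ∈ Finset.range n, m * hitProb σ B (X i ω)) ∂P := by
  have hS : MeasurableSet {p : (ℕ → Plane) × ((ℕ → ℕ) × (ℕ × ℕ → Plane)) |
      ∀ i < n, ∀ j < p.2.1 i, p.1 i + p.2.2 (i, j) ∉ B} := by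
    refine measurableSet_setOfPred.2 (Measurable.forall fun i => Measurable.imp measurable_const
      (Measurable.forall fun j => Measurable.imp ?_ (Measurable.not ?_)))
    · exact measurableSet_setOfPred.1 (measurableSet_lt measurable_const (by fun_prop))
    · exact measurableSet_setOfPred.1 ((by fun_prop : Measurable
        fun p : (ℕ → Plane) × ((ℕ → ℕ) × (ℕ × ℕ → Plane)) => p.1 i + p.2.2 (i, j)) hB)
  have h1 := h.indep_parents_offspring.measure_setOf_eq_lintegral
    (measurable_pi_lambda _ h.parents.measurable)
    ((measurable_pi_lambda _ h.measurable_number).prodMk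
      (measurable_pi_lambda _ h.measurable_displacement)) hS
  simp only [Set.mem_ofPred_eq] at h1
  rw [h1]
  simp_rw [fun ω => h.measure_avoid_of_parents hB (fun i => X i ω) n, expNeg_sum]

/-- The void probabilities of a Thomas cluster process. -/
theorem IsThomasConstruction.measure_avoid [IsProbabilityMeasure P]
    (h : IsThomasConstruction X N Y lam m σ P) {B : Set Plane} (hB : MeasurableSet B)
    (hB' : volume B ≠ ∞) :
    P {ω | ∀ i, ∀ j < N i ω, X i ω + Y (i, j) ω ∉ B}
      = expNeg (lam * ∫⁻ x, (1 - expNeg (m * hitProb σ B x))) := by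
  have := h.isProbabilityMeasure_symmetricNormal
  have hp := measurable_hitProb σ hB
  rw [← h.parents.laplace (hp.const_mul _) (by
    rw [lintegral_const_mul _ hp, lintegral_hitProb σ hB]; finiteness)]
  have hleft : Filter.Tendsto
      (fun n => P {ω | ∀ i < n, ∀ j < N i ω, X i ω + Y (i, j) ω ∉ B}) Filter.atTop
      (nhds (P {ω | ∀ i, ∀ j < N i ω, X i ω + Y (i, j) ω ∉ B})) := by
    have hset : {ω | ∀ i, ∀ j < N i ω, X i ω + Y (i, j) ω ∉ B}
        = ⋂ n, {ω | ∀ i < n, ∀ j < N i ω, X i ω + Y (i, j) ω ∉ B} := by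
      ext ω
      simp only [Set.mem_ofPred_eq, Set.mem_iInter]
      exact ⟨fun H n i _ => H i, fun H i => H (i + 1) i i.lt_succ_self⟩
    rw [hset]
    refine tendsto_measure_iInter_atTop (fun n => MeasurableSet.nullMeasurableSet ?_)
      (fun a b hab ω hω i hi => hω i (hi.trans_le hab)) ⟨0, measure_ne_top _ _⟩
    have hX := h.parents.measurable
    have hN := h.measurable_number
    have hY := h.measurable_displacement
    refine measurableSet_setOfPred.2 (Measurable.forall fun i => Measurable.imp measurable_const
      (Measurable.forall fun j => Measurable.imp ?_ (Measurable.not ?_)))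
    · exact measurableSet_setOfPred.1 (measurableSet_lt measurable_const (hN i))
    · exact measurableSet_setOfPred.1 (((hX i).add (hY (i, j))) hB)
  have hright : Filter.Tendsto
      (fun n => ∫⁻ ω, expNeg (∑ i ∈ Finset.range n, m * hitProb σ B (X i ω)) ∂P) Filter.atTop
      (nhds (∫⁻ ω, expNeg (∑' i, m * hitProb σ B (X i ω)) ∂P)) := by
    refine tendsto_lintegral_of_dominated_convergence (fun _ => 1) (fun n => ?_)
      (fun n => ae_of_all _ fun ω => expNeg_le_one _) (by simp) (ae_of_all _ fun ω => ?_)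
    · exact measurable_expNeg.comp (Finset.measurable_sum _ fun i _ =>
        (hp.comp (h.parents.measurable i)).const_mul _)
    · exact (continuous_expNeg.tendsto _).comp (ENNReal.tendsto_nat_tsum _)
  refine tendsto_nhds_unique hleft ?_
  simp_rw [h.measure_avoid_lt hB]
  exact hright

end

/-! ### The distance of a displaced point from the origin -/

lemma continuous_besselI0 : Continuous besselI0 := by
  unfold besselI0
  exact continuous_const.mul
    (intervalIntegral.continuous_parametric_intervalIntegral_of_continuous' (by fun_prop) _ _)

lemma besselI0_nonneg (x : ℝ) : 0 ≤ besselI0 x :=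
  mul_nonneg (by positivity)
    (intervalIntegral.integral_nonneg Real.pi_pos.le fun _ _ => (Real.exp_pos _).le)

lemma continuous_marcumIntegrand (α : ℝ) : Continuous (marcumIntegrand α) := by
  have := continuous_besselI0
  unfold marcumIntegrand
  fun_prop

lemma marcumIntegrand_nonneg (α : ℝ) {y : ℝ} (hy : 0 ≤ y) : 0 ≤ marcumIntegrand α y :=
  mul_nonneg (by positivity) (besselI0_nonneg _)

/-- The integral over the full circle of directions does not depend on the phase `φ`, and it is
twice the integral over a half-circle. -/
lemma integral_exp_mul_cos_sub (c φ : ℝ) :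
    ∫ θ in (-Real.pi)..Real.pi, Real.exp (c * Real.cos (θ - φ)) = 2 * Real.pi * besselI0 c := by
  have hcont : Continuous fun θ => Real.exp (c * Real.cos θ) := by fun_prop
  have hper : Function.Periodic (fun θ => Real.exp (c * Real.cos θ)) (2 * Real.pi) := fun θ => by
    simp
  have h1 := hper.intervalIntegral_add_eq (-Real.pi - φ) (-Real.pi)
  have h2 : ∫ θ in (-Real.pi)..0, Real.exp (c * Real.cos θ)
      = ∫ θ in (0 : ℝ)..Real.pi, Real.exp (c * Real.cos θ) := by
    have := intervalIntegral.integral_comp_neg (a := 0) (b := Real.pi)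
      fun θ => Real.exp (c * Real.cos θ)
    simpa using this.symm
  rw [intervalIntegral.integral_comp_sub_right fun θ => Real.exp (c * Real.cos θ),
    show Real.pi - φ = -Real.pi - φ + 2 * Real.pi by ring, h1,
    show -Real.pi + 2 * Real.pi = Real.pi by ring,
    ← intervalIntegral.integral_add_adjacent_intervals (hcont.intervalIntegrable _ 0)
      (hcont.intervalIntegrable _ _), h2, besselI0]
  field_simp
  ring

lemma setLIntegral_Ioi_comp_mul_left (g : ℝ → ℝ≥0∞) {σ : ℝ} (hσ : 0 < σ) :
    ∫⁻ t in Set.Ioi 0, g (σ * t) = ENNReal.ofReal σ⁻¹ * ∫⁻ y in Set.Ioi 0, g y := by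
  have he : MeasurableEmbedding fun t : ℝ => σ * t :=
    (Homeomorph.mulLeft₀ σ hσ.ne').measurableEmbedding
  have hpre : (fun t => σ * t) ⁻¹' Set.Ioi 0 = Set.Ioi 0 := by
    ext t; simp [hσ]
  have h := he.restrict_map volume (Set.Ioi 0)
  rw [Real.map_volume_mul_left hσ.ne', hpre, Measure.restrict_smul, abs_of_pos (by positivity)] at h
  rw [← he.lintegral_map, ← h, lintegral_smul_measure, smul_eq_mul]

lemma norm_polarCoord_symm_sub_sq (ρ θ : ℝ) (a : ℂ) :
    ‖Complex.polarCoord.symm (ρ, θ) - a‖ ^ 2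
      = ρ ^ 2 + ‖a‖ ^ 2 - 2 * (ρ * ‖a‖ * Real.cos (θ - a.arg)) := by
  have h := Complex.norm_mul_cos_arg a
  have h' := Complex.norm_mul_sin_arg a
  rw [Complex.sq_norm, Complex.normSq_apply, Real.cos_sub]
  simp only [Complex.polarCoord_symm_apply, Complex.sub_re, Complex.sub_im, Complex.mul_re,
    Complex.mul_im, Complex.add_re, Complex.add_im, Complex.ofReal_re, Complex.ofReal_im,
    Complex.I_re, Complex.I_im]
  rw [← h, ← h']
  linear_combination ρ ^ 2 * Real.sin_sq_add_cos_sq θ + ‖a‖ ^ 2 * Real.sin_sq_add_cos_sq a.arg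

/-- The distance from the origin of a normal displacement of `x`, in units of `σ`, has the Marcum
integrand with parameter `‖x‖ / σ` as its density (the Rice distribution). -/
theorem lintegral_norm_add_symmetricNormal {σ : ℝ} (hσ : 0 < σ) {f : ℝ → ℝ≥0∞}
    (hf : Measurable f) (x : Plane) :
    ∫⁻ y, f ‖x + y‖ ∂symmetricNormal σ
      = ∫⁻ t in Set.Ioi 0, f (σ * t) * ENNReal.ofReal (marcumIntegrand (‖x‖ / σ) t) := by
  let J : ℂ ≃ₗᵢ[ℝ] Plane := Complex.orthonormalBasisOneI.repr
  let C : ℝ := 1 / (2 * Real.pi * σ ^ 2)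
  obtain ⟨a, rfl⟩ := J.surjective x
  -- In the coordinate `w = a + y` the integrand depends on `f` only through the modulus.
  have h1 : ∫⁻ y, f ‖J a + y‖ ∂symmetricNormal σ
      = ∫⁻ w : ℂ, ENNReal.ofReal (C * Real.exp (-‖w - a‖ ^ 2 / (2 * σ ^ 2))) * f ‖w‖ := by
    rw [symmetricNormal, lintegral_withDensity_eq_lintegral_mul _ (by fun_prop) (by fun_prop),
      ← lintegral_sub_right_eq_self _ (J a), ← J.measurePreserving.lintegral_comp (by fun_prop)]
    refine lintegral_congr fun w => ?_
    rw [Pi.mul_apply, ← map_sub, J.norm_map, ← map_add, J.norm_map, add_sub_cancel]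
  -- On the circle of radius `ρ`, the cosine rule isolates `exp (ρ ‖a‖ cos (θ - arg a) / σ²)`, whose
  -- integral over the angle is a Bessel function.
  have h2 : ∀ ρ ∈ Set.Ioi (0 : ℝ), ∫⁻ θ in Set.Ioo (-Real.pi) Real.pi,
      ENNReal.ofReal ρ * (ENNReal.ofReal
        (C * Real.exp (-‖Complex.polarCoord.symm (ρ, θ) - a‖ ^ 2 / (2 * σ ^ 2)))
          * f ‖Complex.polarCoord.symm (ρ, θ)‖)
      = ENNReal.ofReal σ⁻¹ * (f ρ * ENNReal.ofReal (marcumIntegrand (‖a‖ / σ) (ρ / σ))) := by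
    intro ρ hρ
    have hρ : 0 < ρ := hρ
    have h3 : ∀ θ, ENNReal.ofReal ρ * (ENNReal.ofReal
        (C * Real.exp (-‖Complex.polarCoord.symm (ρ, θ) - a‖ ^ 2 / (2 * σ ^ 2)))
          * f ‖Complex.polarCoord.symm (ρ, θ)‖)
        = f ρ * (ENNReal.ofReal (ρ * C * Real.exp (-(ρ ^ 2 + ‖a‖ ^ 2) / (2 * σ ^ 2)))
          * ENNReal.ofReal (Real.exp (‖a‖ / σ * (ρ / σ) * Real.cos (θ - a.arg)))) := fun θ => by
      have hexp : Real.exp (-(ρ ^ 2 + ‖a‖ ^ 2 - 2 * (ρ * ‖a‖ * Real.cos (θ - a.arg))) / (2 * σ ^ 2))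
          = Real.exp (-(ρ ^ 2 + ‖a‖ ^ 2) / (2 * σ ^ 2))
            * Real.exp (‖a‖ / σ * (ρ / σ) * Real.cos (θ - a.arg)) := by
        rw [← Real.exp_add]
        congr 1
        field_simp
        ring
      rw [Complex.norm_polarCoord_symm, abs_of_pos hρ, norm_polarCoord_symm_sub_sq, hexp,
        ← mul_assoc, ← ENNReal.ofReal_mul hρ.le, mul_comm _ (f ρ),
        ← ENNReal.ofReal_mul (by positivity)]
      congr 2
      ring
    have hcont : Continuous fun θ => Real.exp (‖a‖ / σ * (ρ / σ) * Real.cos (θ - a.arg)) := by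
      fun_prop
    simp_rw [h3]
    rw [lintegral_const_mul _ (by fun_prop), lintegral_const_mul _ (by fun_prop),
      ← ofReal_integral_eq_lintegral_ofReal
        ((hcont.integrableOn_Icc (a := -Real.pi) (b := Real.pi)).mono_set Set.Ioo_subset_Icc_self)
        (ae_of_all _ fun θ => (Real.exp_pos _).le),
      ← integral_Ioc_eq_integral_Ioo,
      ← intervalIntegral.integral_of_le (by linarith [Real.pi_pos]), integral_exp_mul_cos_sub,
      ← ENNReal.ofReal_mul (by positivity), mul_left_comm (ENNReal.ofReal σ⁻¹),
      ← ENNReal.ofReal_mul (by positivity)]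
    congr 2
    rw [marcumIntegrand]
    have h4 : -((ρ / σ) ^ 2 + (‖a‖ / σ) ^ 2) / 2 = -(ρ ^ 2 + ‖a‖ ^ 2) / (2 * σ ^ 2) := by
      field_simp
    rw [h4]
    simp only [C]
    have := Real.pi_pos
    field_simp
  have hmeas : Measurable fun p : ℝ × ℝ => ENNReal.ofReal p.1 * (ENNReal.ofReal
        (C * Real.exp (-‖Complex.polarCoord.symm p - a‖ ^ 2 / (2 * σ ^ 2)))
          * f ‖Complex.polarCoord.symm p‖) := by
    have : Measurable fun p : ℝ × ℝ => Complex.polarCoord.symm p := by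
      simp only [Complex.polarCoord_symm_apply]
      fun_prop
    fun_prop
  rw [h1, ← Complex.lintegral_comp_polarCoord_symm, polarCoord_target, Measure.volume_eq_prod,
    ← Measure.prod_restrict]
  simp only [smul_eq_mul]
  rw [lintegral_prod _ hmeas.aemeasurable,
    setLIntegral_congr_fun measurableSet_Ioi h2, J.norm_map]
  have h5 := continuous_marcumIntegrand (‖a‖ / σ)
  rw [lintegral_const_mul _ (by fun_prop), ← setLIntegral_Ioi_comp_mul_left _ hσ]
  refine lintegral_congr fun t => ?_
  rw [mul_div_cancel_left₀ _ hσ.ne']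

/-! ### Balls and the Marcum Q-function -/

/-- The Marcum integrand is a probability density, being that of the distance of a normally
displaced point from the origin. -/
lemma lintegral_marcumIntegrand {σ : ℝ} (hσ : 0 < σ) [IsProbabilityMeasure (symmetricNormal σ)]
    {v : ℝ} (hv : 0 ≤ v) :
    ∫⁻ t in Set.Ioi 0, ENNReal.ofReal (marcumIntegrand (v / σ) t) = 1 := by
  obtain ⟨x, hx⟩ := exists_norm_eq Plane hv
  have h := lintegral_norm_add_symmetricNormal hσ (f := fun _ => 1) measurable_const x
  simpa [hx] using h.symm

lemma integrableOn_marcumIntegrand {σ : ℝ} (hσ : 0 < σ) [IsProbabilityMeasure (symmetricNormal σ)]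
    {v : ℝ} (hv : 0 ≤ v) : IntegrableOn (marcumIntegrand (v / σ)) (Set.Ioi 0) := by
  refine ⟨(continuous_marcumIntegrand _).aestronglyMeasurable, ?_⟩
  rw [hasFiniteIntegral_iff_ofReal ((ae_restrict_iff' measurableSet_Ioi).2
    (ae_of_all _ fun t ht => marcumIntegrand_nonneg _ (le_of_lt ht))),
    lintegral_marcumIntegrand hσ hv]
  exact ENNReal.one_lt_top

/-- The density of the distance integrates to one, so the mass it gives to `(0, b]` is the
complement of the Marcum Q-function. -/
lemma one_sub_marcumQ {σ : ℝ} (hσ : 0 < σ) [IsProbabilityMeasure (symmetricNormal σ)]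
    {v b : ℝ} (hv : 0 ≤ v) (hb : 0 ≤ b) :
    1 - marcumQ (v / σ) b = ∫ t in Set.Ioc 0 b, marcumIntegrand (v / σ) t := by
  have hint := integrableOn_marcumIntegrand hσ hv
  have h1 : ∫ t in Set.Ioi 0, marcumIntegrand (v / σ) t = 1 := by
    rw [integral_eq_lintegral_of_nonneg_ae ((ae_restrict_iff' measurableSet_Ioi).2
      (ae_of_all _ fun t ht => marcumIntegrand_nonneg _ (le_of_lt ht))) hint.1,
      lintegral_marcumIntegrand hσ hv, ENNReal.toReal_one]
  have h2 := setIntegral_union (f := marcumIntegrand (v / σ)) (μ := volume)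
    (Set.Ioc_disjoint_Ioi (le_refl b) (a := 0)) measurableSet_Ioi
    (hint.mono_set Set.Ioc_subset_Ioi_self) (hint.mono_set (Set.Ioi_subset_Ioi hb))
  rw [Set.Ioc_union_Ioi_eq_Ioi hb, h1] at h2
  rw [h2, marcumQ]
  ring

lemma one_sub_marcumQ_nonneg {σ : ℝ} (hσ : 0 < σ) [IsProbabilityMeasure (symmetricNormal σ)]
    {v b : ℝ} (hv : 0 ≤ v) (hb : 0 ≤ b) : 0 ≤ 1 - marcumQ (v / σ) b := by
  rw [one_sub_marcumQ hσ hv hb]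
  exact setIntegral_nonneg measurableSet_Ioc fun t ht => marcumIntegrand_nonneg _ ht.1.le

lemma hitProb_closedBall {σ : ℝ} (hσ : 0 < σ) [IsProbabilityMeasure (symmetricNormal σ)]
    (z x : Plane) {r : ℝ} (hr : 0 ≤ r) :
    hitProb σ (Metric.closedBall z r) x
      = ENNReal.ofReal (1 - marcumQ (‖x - z‖ / σ) (r / σ)) := by
  have h := lintegral_norm_add_symmetricNormal hσ (f := (Set.Iic r).indicator 1)
    (measurable_one.indicator measurableSet_Iic) (x - z)
  have hl : ∀ y, (Set.Iic r).indicator (1 : ℝ → ℝ≥0∞) ‖x - z + y‖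
      = {y | x + y ∈ Metric.closedBall z r}.indicator 1 y := fun y => by
    have : x - z + y = x + y - z := by abel
    simp [Set.indicator, this, dist_eq_norm]
  have hrr : ∀ t, (Set.Iic r).indicator (1 : ℝ → ℝ≥0∞) (σ * t)
        * ENNReal.ofReal (marcumIntegrand (‖x - z‖ / σ) t)
      = (Set.Iic (r / σ)).indicator
        (fun t => ENNReal.ofReal (marcumIntegrand (‖x - z‖ / σ) t)) t := fun t => by
    simp [Set.indicator, le_div_iff₀' hσ]
  simp_rw [hl, hrr] at h
  have hS : MeasurableSet {y | x + y ∈ Metric.closedBall z r} :=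
    measurable_const_add x Metric.isClosed_closedBall.measurableSet
  rw [lintegral_indicator_one hS,
    setLIntegral_indicator measurableSet_Iic, Set.inter_comm, Set.Ioi_inter_Iic] at h
  rw [one_sub_marcumQ hσ (norm_nonneg _) (by positivity), hitProb, h,
    ofReal_integral_eq_lintegral_ofReal ((integrableOn_marcumIntegrand hσ
      (norm_nonneg _)).mono_set Set.Ioc_subset_Ioi_self)
      ((ae_restrict_iff' measurableSet_Ioc).2
        (ae_of_all _ fun t ht => marcumIntegrand_nonneg _ ht.1.le))]

/-- Integration in polar coordinates around `z`. -/
lemma integrableOn_and_lintegral_of_radial {h : ℝ → ℝ} (hh : ∀ v, 0 ≤ v → 0 ≤ h v) (z : Plane)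
    (hmeas : AEStronglyMeasurable (fun x : Plane => h ‖x - z‖) volume)
    (hfin : ∫⁻ x : Plane, ENNReal.ofReal (h ‖x - z‖) ≠ ∞) :
    IntegrableOn (fun v => h v * v) (Set.Ioi 0) ∧
      (∫⁻ x : Plane, ENNReal.ofReal (h ‖x - z‖)).toReal
        = 2 * Real.pi * ∫ v in Set.Ioi 0, h v * v := by
  have hnn : 0 ≤ᵐ[volume] fun x : Plane => h ‖x - z‖ := ae_of_all _ fun x => hh _ (norm_nonneg _)
  have hint : Integrable fun x : Plane => h ‖x - z‖ :=
    ⟨hmeas, (hasFiniteIntegral_iff_ofReal hnn).2 hfin.lt_top⟩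
  have hint0 : Integrable fun x : Plane => h ‖x‖ := by
    simpa using hint.comp_add_right z
  have hdim : Module.finrank ℝ Plane - 1 = 1 := by simp
  constructor
  · have := (integrable_fun_norm_addHaar volume).1 hint0
    simpa [hdim, mul_comm] using this
  · rw [← integral_eq_lintegral_of_nonneg_ae hnn hmeas,
      integral_sub_right_eq_self (fun x : Plane => h ‖x‖) z,
      integral_fun_norm_addHaar, hdim]
    have hvol : (volume : Measure Plane).real (Metric.ball 0 1) = Real.pi := by
      simp [Measure.real, EuclideanSpace.volume_ball_fin_two, Real.pi_pos.le]
    rw [hvol]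
    simp [mul_comm, mul_assoc, mul_left_comm]

lemma iInter_closedBall_add_one_div {E : Type*} [PseudoMetricSpace E] (z : E) (r : ℝ) :
    ⋂ n : ℕ, Metric.closedBall z (r + 1 / ((n : ℝ) + 1)) = Metric.closedBall z r := by
  ext x
  simp only [Set.mem_iInter, Metric.mem_closedBall]
  constructor
  · intro h
    refine ge_of_tendsto' (f := fun n : ℕ => r + 1 / ((n : ℝ) + 1)) (x := Filter.atTop) ?_ h
    simpa using tendsto_one_div_add_atTop_nhds_zero_nat.const_add r
  · intro h n
    have : 0 < 1 / ((n : ℝ) + 1) := by positivity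
    linarith

lemma antitone_add_one_div (r : ℝ) : Antitone fun n : ℕ => r + 1 / ((n : ℝ) + 1) :=
  fun a b hab => by
    have : (a : ℝ) ≤ b := by exact_mod_cast hab
    dsimp only
    gcongr

/-- Right-continuity in the radius of the exponent of the void probability of a ball. -/
lemma tendsto_lintegral_one_sub_expNeg_hitProb (σ : ℝ) [IsProbabilityMeasure (symmetricNormal σ)]
    (m : ℝ≥0) (z : Plane) (r : ℝ) :
    Filter.Tendsto (fun n : ℕ => ∫⁻ x, (1 - expNeg
        (m * hitProb σ (Metric.closedBall z (r + 1 / ((n : ℝ) + 1))) x))) Filter.atTop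
      (nhds (∫⁻ x, (1 - expNeg (m * hitProb σ (Metric.closedBall z r) x)))) := by
  have hB : ∀ r, MeasurableSet (Metric.closedBall z r) :=
    fun r => Metric.isClosed_closedBall.measurableSet
  refine tendsto_lintegral_of_dominated_convergence
    (fun x => m * hitProb σ (Metric.closedBall z (r + 1)) x) (fun n => ?_)
    (fun n => ae_of_all _ fun x => ?_) ?_ (ae_of_all _ fun x => ?_)
  · have := measurable_hitProb σ (hB (r + 1 / ((n : ℝ) + 1)))
    fun_prop
  · refine (one_sub_expNeg_le _).trans ?_
    have h0 := antitone_add_one_div r n.zero_le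
    simp only [CharP.cast_eq_zero, zero_add, div_one] at h0
    exact mul_le_mul' le_rfl (hitProb_mono σ (Metric.closedBall_subset_closedBall h0) x)
  · rw [lintegral_const_mul _ (measurable_hitProb σ (hB _)), lintegral_hitProb σ (hB _)]
    exact ENNReal.mul_ne_top ENNReal.coe_ne_top measure_closedBall_lt_top.ne
  · refine ENNReal.Tendsto.sub tendsto_const_nhds ((continuous_expNeg.tendsto _).comp
      (ENNReal.Tendsto.const_mul ?_ (Or.inr ENNReal.coe_ne_top))) (Or.inl ENNReal.one_ne_top)
    change Filter.Tendsto (fun n : ℕ => symmetricNormal σ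
        ((x + ·) ⁻¹' Metric.closedBall z (r + 1 / ((n : ℝ) + 1)))) Filter.atTop
      (nhds (symmetricNormal σ ((x + ·) ⁻¹' Metric.closedBall z r)))
    rw [← iInter_closedBall_add_one_div z r, Set.preimage_iInter]
    exact tendsto_measure_iInter_atTop
      (fun n => (measurable_const_add x (hB _)).nullMeasurableSet)
      (fun a b hab => Set.preimage_mono
        (Metric.closedBall_subset_closedBall (antitone_add_one_div r hab)))
      ⟨0, measure_ne_top _ _⟩

/-! ### Hitting events and the contact distance -/

variable {Ω : Type*} [MeasurableSpace Ω] {X : ℕ → Ω → Plane} {N : ℕ → Ω → ℕ}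
  {Y : ℕ × ℕ → Ω → Plane} {lam m : ℝ≥0} {σ : ℝ} {P : Measure Ω}

lemma nonempty_iUnion_cluster_inter_iff {Ω : Type*} {X : ℕ → Ω → Plane} {N : ℕ → Ω → ℕ}
    {Y : ℕ × ℕ → Ω → Plane} {B : Set Plane} {ω : Ω} :
    ((⋃ i, cluster X N Y i ω) ∩ B).Nonempty ↔ ∃ i, ∃ j < N i ω, X i ω + Y (i, j) ω ∈ B := by
  constructor
  · rintro ⟨y, hy, hyB⟩
    obtain ⟨i, j, hj, rfl⟩ := Set.mem_iUnion.1 hy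
    exact ⟨i, j, hj, hyB⟩
  · rintro ⟨i, j, hj, h⟩
    exact ⟨_, Set.mem_iUnion.2 ⟨i, j, hj, rfl⟩, h⟩

lemma IsThomasConstruction.measurableSet_hit (h : IsThomasConstruction X N Y lam m σ P)
    {B : Set Plane} (hB : MeasurableSet B) :
    MeasurableSet {ω | ((⋃ i, cluster X N Y i ω) ∩ B).Nonempty} := by
  simp_rw [nonempty_iUnion_cluster_inter_iff]
  refine measurableSet_setOfPred.2 (Measurable.exists fun i => Measurable.exists fun j =>
    Measurable.and ?_ ?_)
  · exact measurableSet_setOfPred.1 (measurableSet_lt measurable_const (h.measurable_number i))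
  · exact measurableSet_setOfPred.1
      (((h.parents.measurable i).add (h.measurable_displacement (i, j))) hB)

/-- The capacity functional of a Thomas cluster process. -/
lemma IsThomasConstruction.measure_hit [IsProbabilityMeasure P]
    (h : IsThomasConstruction X N Y lam m σ P) {B : Set Plane} (hB : MeasurableSet B)
    (hB' : volume B ≠ ∞) :
    P {ω | ((⋃ i, cluster X N Y i ω) ∩ B).Nonempty}
      = 1 - expNeg (lam * ∫⁻ x, (1 - expNeg (m * hitProb σ B x))) := by
  rw [← h.measure_avoid hB hB', ← compl_compl {ω | ((⋃ i, cluster X N Y i ω) ∩ B).Nonempty},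
    prob_compl_eq_one_sub (h.measurableSet_hit hB).compl]
  congr 2
  ext ω
  simp [nonempty_iUnion_cluster_inter_iff]

lemma IsThomasConstruction.measurable_infEDist (h : IsThomasConstruction X N Y lam m σ P)
    (z : Plane) : Measurable fun ω => Metric.infEDist z (⋃ i, cluster X N Y i ω) := by
  have heq : (fun ω => Metric.infEDist z (⋃ i, cluster X N Y i ω))
      = fun ω => ⨅ i, ⨅ j, if j < N i ω then edist z (X i ω + Y (i, j) ω) else ∞ := by
    ext ω
    rw [Metric.infEDist_iUnion]
    congr with i
    refine le_antisymm (le_iInf fun j => ?_) ?_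
    · split_ifs with hj
      · exact Metric.infEDist_le_edist_of_mem ⟨j, hj, rfl⟩
      · exact le_top
    · refine Metric.le_infEDist.2 ?_
      rintro _ ⟨j, hj, rfl⟩
      exact (iInf_le _ j).trans_eq (if_pos hj)
  rw [heq]
  refine Measurable.iInf fun i => Measurable.iInf fun j =>
    Measurable.ite (measurableSet_lt measurable_const (h.measurable_number i)) ?_ measurable_const
  exact measurable_const.edist ((h.parents.measurable i).add (h.measurable_displacement (i, j)))

lemma infEDist_le_ofReal_iff {E : Type*} [PseudoMetricSpace E] {z : E} {S : Set E} {r : ℝ}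
    (hr : 0 ≤ r) :
    Metric.infEDist z S ≤ ENNReal.ofReal r ↔
      ∀ n : ℕ, (S ∩ Metric.closedBall z (r + 1 / ((n : ℝ) + 1))).Nonempty := by
  constructor
  · intro h n
    have hn : 0 < 1 / ((n : ℝ) + 1) := by positivity
    obtain ⟨y, hy, hlt⟩ := Metric.infEDist_lt_iff.1
      (h.trans_lt ((ENNReal.ofReal_lt_ofReal_iff (by positivity)).2 (lt_add_of_pos_right r hn)))
    rw [edist_dist, ENNReal.ofReal_lt_ofReal_iff (by positivity)] at hlt
    exact ⟨y, hy, by rw [Metric.mem_closedBall, dist_comm]; exact hlt.le⟩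
  · intro h
    have hlim : Filter.Tendsto (fun n : ℕ => ENNReal.ofReal (r + 1 / ((n : ℝ) + 1))) Filter.atTop
        (nhds (ENNReal.ofReal r)) := by
      refine ENNReal.tendsto_ofReal ?_
      simpa using tendsto_one_div_add_atTop_nhds_zero_nat.const_add r
    refine ge_of_tendsto' hlim fun n => ?_
    obtain ⟨y, hy, hyB⟩ := h n
    refine (Metric.infEDist_le_edist_of_mem hy).trans ?_
    rw [edist_dist, dist_comm]
    exact ENNReal.ofReal_le_ofReal hyB

/-- The contact distance need not be attained, so `{infEDist ≤ r}` is only known to be the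
decreasing limit of the events that slightly larger balls are hit; by continuity of the capacity
functional it has the same probability as the event that the closed ball itself is hit. -/
lemma IsThomasConstruction.measure_infEDist_le [IsProbabilityMeasure P]
    (h : IsThomasConstruction X N Y lam m σ P) (z : Plane) {r : ℝ} (hr : 0 ≤ r) :
    P {ω | Metric.infEDist z (⋃ i, cluster X N Y i ω) ≤ ENNReal.ofReal r}
      = 1 - expNeg (lam * ∫⁻ x, (1 - expNeg (m * hitProb σ (Metric.closedBall z r) x))) := by
  have := h.isProbabilityMeasure_symmetricNormal
  have hB : ∀ r, MeasurableSet (Metric.closedBall z r) :=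
    fun r => Metric.isClosed_closedBall.measurableSet
  have hset : {ω | Metric.infEDist z (⋃ i, cluster X N Y i ω) ≤ ENNReal.ofReal r}
      = ⋂ n : ℕ, {ω | ((⋃ i, cluster X N Y i ω)
          ∩ Metric.closedBall z (r + 1 / ((n : ℝ) + 1))).Nonempty} := by
    ext ω
    simp only [Set.mem_ofPred_eq, Set.mem_iInter, infEDist_le_ofReal_iff hr]
  have hleft := tendsto_measure_iInter_atTop (μ := P)
    (s := fun n : ℕ => {ω | ((⋃ i, cluster X N Y i ω)
          ∩ Metric.closedBall z (r + 1 / ((n : ℝ) + 1))).Nonempty})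
    (fun n => (h.measurableSet_hit (hB _)).nullMeasurableSet)
    (fun a b hab ω hω => hω.mono (Set.inter_subset_inter_right _
      (Metric.closedBall_subset_closedBall (antitone_add_one_div r hab))))
    ⟨0, measure_ne_top _ _⟩
  rw [hset]
  refine tendsto_nhds_unique hleft ?_
  refine Filter.Tendsto.congr
    (fun n : ℕ => (h.measure_hit (hB (r + 1 / ((n : ℝ) + 1))) measure_closedBall_lt_top.ne).symm) ?_
  exact ENNReal.Tendsto.sub tendsto_const_nhds ((continuous_expNeg.tendsto _).comp
    (ENNReal.Tendsto.const_mul (tendsto_lintegral_one_sub_expNeg_hitProb σ m z r)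
      (Or.inr ENNReal.coe_ne_top))) (Or.inl ENNReal.one_ne_top)

/-- The exponent of the void probability of a ball in terms of the Marcum Q-function. -/
lemma integrableOn_and_lintegral_one_sub_expNeg_hitProb (hσ : 0 < σ)
    [IsProbabilityMeasure (symmetricNormal σ)] (m : ℝ≥0) (z : Plane) {r : ℝ} (hr : 0 ≤ r) :
    IntegrableOn (fun v : ℝ =>
        (1 - Real.exp (-(m : ℝ) * (1 - marcumQ (v / σ) (r / σ)))) * v) (Set.Ioi 0) ∧
      ∫⁻ x, (1 - expNeg (m * hitProb σ (Metric.closedBall z r) x)) ≠ ∞ ∧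
      (∫⁻ x, (1 - expNeg (m * hitProb σ (Metric.closedBall z r) x))).toReal
        = 2 * Real.pi * ∫ v in Set.Ioi (0 : ℝ),
          (1 - Real.exp (-(m : ℝ) * (1 - marcumQ (v / σ) (r / σ)))) * v := by
  have hB : MeasurableSet (Metric.closedBall z r) := Metric.isClosed_closedBall.measurableSet
  have hp := measurable_hitProb σ hB
  have hQ : ∀ v, 0 ≤ v → 0 ≤ 1 - marcumQ (v / σ) (r / σ) := fun v hv =>
    one_sub_marcumQ_nonneg hσ hv (by positivity)
  have hh : ∀ v, 0 ≤ v → 0 ≤ 1 - Real.exp (-(m : ℝ) * (1 - marcumQ (v / σ) (r / σ))) :=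
    fun v hv => by
      have := mul_nonneg m.coe_nonneg (hQ v hv)
      rw [sub_nonneg, Real.exp_le_one_iff, neg_mul, neg_nonpos]
      exact this
  have heq : ∀ x : Plane, 1 - expNeg (m * hitProb σ (Metric.closedBall z r) x)
      = ENNReal.ofReal (1 - Real.exp (-(m : ℝ) * (1 - marcumQ (‖x - z‖ / σ) (r / σ)))) :=
    fun x => by
      rw [hitProb_closedBall hσ z x hr, ← ENNReal.ofReal_coe_nnreal,
        ← ENNReal.ofReal_mul m.coe_nonneg,
        expNeg_ofReal (mul_nonneg m.coe_nonneg (hQ _ (norm_nonneg _))),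
        ENNReal.ofReal_sub _ (Real.exp_pos _).le, ENNReal.ofReal_one, neg_mul]
  have hfin : ∫⁻ x, (1 - expNeg (m * hitProb σ (Metric.closedBall z r) x)) ≠ ∞ := by
    refine ne_top_of_le_ne_top ?_ (lintegral_mono fun x => one_sub_expNeg_le _)
    rw [lintegral_const_mul _ hp, lintegral_hitProb σ hB]
    exact ENNReal.mul_ne_top ENNReal.coe_ne_top measure_closedBall_lt_top.ne
  have hmeas : Measurable fun x : Plane =>
      1 - Real.exp (-(m : ℝ) * (1 - marcumQ (‖x - z‖ / σ) (r / σ))) := by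
    have h1 : Measurable fun x =>
        (1 - expNeg (m * hitProb σ (Metric.closedBall z r) x)).toReal := by
      fun_prop
    refine (congrArg Measurable (funext fun x => ?_)).mp h1
    rw [heq, ENNReal.toReal_ofReal (hh _ (norm_nonneg _))]
  have key := integrableOn_and_lintegral_of_radial hh z hmeas.aestronglyMeasurable (by
    simp_rw [← heq]; exact hfin)
  simp_rw [← heq] at key
  exact ⟨key.1, hfin, key.2⟩

end ThomasCluster

theorem theorem1 {Ω : Type*} [MeasurableSpace Ω] (P : Measure Ω) [IsProbabilityMeasure P]
    (lam m : ℝ≥0) (σ : ℝ) (hlam : 0 < lam) (hσ : 0 < σ)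
    (Ψ : Ω → Set ThomasCluster.Plane)
    (hΨ : ThomasCluster.IsThomasClusterProcess Ψ lam m σ P)
    (z : ThomasCluster.Plane) :
    AEMeasurable (ThomasCluster.contactDistance Ψ z) P ∧
    ∀ r : ℝ, 0 ≤ r →
      (∀ v : ℝ, 0 ≤ v →
        IntegrableOn (ThomasCluster.marcumIntegrand (v / σ)) (Set.Ioi (r / σ))) ∧
      IntegrableOn
        (fun v : ℝ =>
          (1 - Real.exp (-(m : ℝ) * (1 - ThomasCluster.marcumQ (v / σ) (r / σ)))) * v)
        (Set.Ioi 0) ∧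
      P.real {ω | ThomasCluster.contactDistance Ψ z ω ≤ ENNReal.ofReal r} =
        1 - Real.exp (-2 * Real.pi * (lam : ℝ) *
          ∫ v in Set.Ioi (0 : ℝ),
            (1 - Real.exp (-(m : ℝ) * (1 - ThomasCluster.marcumQ (v / σ) (r / σ)))) * v) ∧
      P.real {ω | 0 < (Ψ ω ∩ Metric.closedBall z r).encard} =
        1 - Real.exp (-2 * Real.pi * (lam : ℝ) *
          ∫ v in Set.Ioi (0 : ℝ),
            (1 - Real.exp (-(m : ℝ) * (1 - ThomasCluster.marcumQ (v / σ) (r / σ)))) * v) := by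
  open ThomasCluster in
  obtain ⟨X, N, Y, h, hΨ⟩ := hΨ
  have := h.isProbabilityMeasure_symmetricNormal
  refine ⟨⟨_, h.measurable_infEDist z, ?_⟩, fun r hr => ?_⟩
  · filter_upwards [hΨ] with ω hω
    rw [contactDistance, hω]
  obtain ⟨hint, hfin, hval⟩ := integrableOn_and_lintegral_one_sub_expNeg_hitProb hσ m z hr
  have hformula : (1 - expNeg (lam * ∫⁻ x,
      (1 - expNeg (m * hitProb σ (Metric.closedBall z r) x)))).toReal
      = 1 - Real.exp (-2 * Real.pi * (lam : ℝ) * ∫ v in Set.Ioi (0 : ℝ),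
            (1 - Real.exp (-(m : ℝ) * (1 - marcumQ (v / σ) (r / σ)))) * v) := by
    rw [ENNReal.toReal_sub_of_le (expNeg_le_one _) ENNReal.one_ne_top, ENNReal.toReal_one,
      toReal_expNeg (ENNReal.mul_ne_top ENNReal.coe_ne_top hfin), ENNReal.toReal_mul, hval,
      ENNReal.coe_toReal]
    congr 2
    ring
  refine ⟨fun v hv => (integrableOn_marcumIntegrand hσ hv).mono_set
    (Set.Ioi_subset_Ioi (by positivity)), hint, ?_, ?_⟩
  · rw [← hformula, ← h.measure_infEDist_le z hr, Measure.real]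
    congr 1
    refine measure_congr ?_
    filter_upwards [hΨ] with ω hω
    refine propext ?_
    change contactDistance Ψ z ω ≤ _ ↔ _
    rw [contactDistance, hω]
    rfl
  · rw [← hformula, ← h.measure_hit Metric.isClosed_closedBall.measurableSet
      measure_closedBall_lt_top.ne, Measure.real]
    congr 1
    refine measure_congr ?_
    filter_upwards [hΨ] with ω hω
    refine propext ?_
    change 0 < (Ψ ω ∩ Metric.closedBall z r).encard ↔ _
    rw [Set.encard_pos, hω]
    rfl
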